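/- For $n\ge 1$ and a permutation matrix $\Pi\in\mathcal S_n$ (identified with the corresponding permutation of $\{1,\dots,n\}$) write $\Pi\cdot M=\Pi M\Pi^{\top}$. A real symmetric $n\times n$ matrix $R$ is called Robinson if for every $i$ its $i$-th row satisfies $R_{i1}\le\dots\le R_{ii}\ge\dots\ge R_{in}$; let $\mathcal R_n$ be the set of these matrices. For $u>0$ let $\varphi_{u,n}(x)=u\,\mathbf 1\{|x|\le 1/n\}$. Let $V_1,\dots,V_n$ be i.i.d. uniform on $[0,1]$, put $X_{ij}=\varphi_{u,n}(V_i-V_j)$, and suppose that one observes $Y=X+E$, where $E$ is an $n\times n$ matrix, independent of $V$, whose $n^2$ entries are i.i.d. $\mathcal N(0,1)$. An estimator is a measurable map $\widehat\Pi=\widehat\Pi(Y)$ with values in $\mathcal S_n$ (it may depend on $u$ and $n$), and its loss is $\ell_2(\widehat\Pi)=\inf_{R\in\mathcal R_n}\|\widehat\Pi\cdot X-R\|_F$, where $\|\cdot\|_F$ is the Frobenius norm. Theorem. For every constant $C>0$ there are a constant $c>0$ and an integer $N$, depending only on $C$, such that the following holds. For every $u\in(0,C]$ and every integer $n_0\ge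 N$ there is an integer $n\in[n_0/2,\,2n_0]$ such that every estimator $\widehat\Pi$ satisfies $$\mathbb E\big[\ell_2(\widehat\Pi)\big]\;\ge\; c\,u\sqrt n ,$$ where the expectation is over $V$ and $E$. -/

import Mathlib

open MeasureTheory ProbabilityTheory

namespace Seriation

/-- A vector `x` is unimodal with respect to the index `i`: it is non-decreasing up to `i` and
non-increasing from `i` on. -/
def UnimodalAt {n : ℕ} (x : Fin n → ℝ) (i : Fin n) : Prop :=
  (∀ j k : Fin n, j ≤ k → k ≤ i → x j ≤ x k) ∧ (∀ j k : Fin n, i ≤ j → j ≤ k → x k ≤ x j)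

/-- A Robinson matrix: symmetric, each row being unimodal with respect to its diagonal index. -/
def IsRobinson {n : ℕ} (M : Matrix (Fin n) (Fin n) ℝ) : Prop :=
  M.IsSymm ∧ ∀ i, UnimodalAt (M i) i

/-- The Frobenius norm of a real square matrix. -/
noncomputable def frobenius {n : ℕ} (M : Matrix (Fin n) (Fin n) ℝ) : ℝ :=
  Real.sqrt (∑ i, ∑ j, M i j ^ 2)

/-- The action `Π · M = Π M Πᵀ` of a permutation on square matrices. -/
noncomputable def permAct {n : ℕ} (σ : Equiv.Perm (Fin n)) (M : Matrix (Fin n) (Fin n) ℝ) :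
    Matrix (Fin n) (Fin n) ℝ :=
  σ.permMatrix ℝ * M * (σ.permMatrix ℝ).transpose

theorem permAct_apply {n : ℕ} (σ : Equiv.Perm (Fin n)) (M : Matrix (Fin n) (Fin n) ℝ)
    (i j : Fin n) : permAct σ M i j = M (σ i) (σ j) := by
  simp only [permAct, Matrix.mul_apply, Matrix.transpose_apply, Equiv.Perm.permMatrix,
    PEquiv.toMatrix_apply, Equiv.toPEquiv_apply, Option.mem_def, Option.some.injEq, ite_mul,
    one_mul, zero_mul, Finset.sum_ite_eq, Finset.mem_univ, if_true, mul_ite, mul_one, mul_zero]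

/-- The `ℓ₂` seriation loss of the ordering `σ` for the signal matrix `X`: the Frobenius distance
from `Π · X` to the set of Robinson matrices. -/
noncomputable def loss {n : ℕ} (X : Matrix (Fin n) (Fin n) ℝ) (σ : Equiv.Perm (Fin n)) : ℝ :=
  ⨅ R : {R : Matrix (Fin n) (Fin n) ℝ // IsRobinson R}, frobenius (permAct σ X - R.1)

/-- The infimum defining `loss` is over a non-empty set, of non-negative numbers. -/
theorem isRobinson_zero (n : ℕ) : IsRobinson (0 : Matrix (Fin n) (Fin n) ℝ) :=
  ⟨Matrix.transpose_zero, fun _ => ⟨fun _ _ _ _ => le_rfl, fun _ _ _ _ => le_rfl⟩⟩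

/-- The function `φ(x) = u · 1{|x| ≤ 1/n}`. -/
noncomputable def bandFun (u : ℝ) (n : ℕ) (x : ℝ) : ℝ :=
  if |x| ≤ 1 / (n : ℝ) then u else 0

/-- The latent position signal matrix `X i j = φ (V i - V j)`. -/
def latentMatrix {n : ℕ} (φ : ℝ → ℝ) (V : Fin n → ℝ) : Matrix (Fin n) (Fin n) ℝ :=
  Matrix.of fun i j => φ (V i - V j)

/-- The law of `n` independent positions, uniform on `[0, 1]`. -/
noncomputable def positionLaw (n : ℕ) : Measure (Fin n → ℝ) :=
  Measure.pi fun _ => (volume : Measure ℝ).restrict (Set.Icc 0 1)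

/-- The law of an `n × n` noise matrix with independent `N(0, 1)` entries. -/
noncomputable def noiseLaw (n : ℕ) : Measure (Fin n → Fin n → ℝ) :=
  Measure.pi fun _ : Fin n => Measure.pi fun _ : Fin n => gaussianReal 0 1

/-- An estimator of the ordering: a measurable map from data matrices to the finite set of
permutations (that is, one all of whose fibres are measurable). -/
structure Estimator (n : ℕ) where
  toFun : (Fin n → Fin n → ℝ) → Equiv.Perm (Fin n)
  measurableSet_fiber : ∀ σ, MeasurableSet (toFun ⁻¹' {σ})

/-- The risk `𝔼[ℓ₂(Π̂)]` of an estimator which observes `Y = X + E`, where `X i j = φ (V i - V j)`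
with `V` uniform, and the noise `E` is standard Gaussian and independent of `V`. -/
noncomputable def risk {n : ℕ} (φ : ℝ → ℝ) (S : Estimator n) : ℝ :=
  ∫ p : (Fin n → ℝ) × (Fin n → Fin n → ℝ),
    loss (latentMatrix φ p.1) (S.toFun fun i j => latentMatrix φ p.1 i j + p.2 i j)
      ∂((positionLaw n).prod (noiseLaw n))

end Seriation

namespace Seriation

/-! ### Gaussian perturbations of nearby matrices overlap -/

/-! At bandwidth `1 / n` the signal is `u` times the adjacency matrix of a sparse random graph, in
which the expected number of isolated pairs (components with two vertices) is of order `n`. If an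
ordering separates an isolated pair, some vertex placed between the two has entry `0` where a
Robinson row would have to be at least as large as at the partner; this costs `u ^ 2 / 2` in that
row (`half_sq_le_row`). With `M` misplaced ordered pairs the loss is thus at least of order `u *
√M`, and since `M ≤ n` this is at least of order `u * M / √n` (`misplacedCount_le_loss`). It remains
to show that `M` has expectation of order `n`.

Take two isolated pairs `{i, j}` and `{k, l}`. Exchanging the positions of `j` and `l` preserves the
law of the positions, turns the pairs into `{i, l}` and `{k, j}`, and changes at most 8 entries of
the signal, each by at most `C`; the two laws of the data therefore overlap by a constant
(`gaussianFloor_pow_le_error`). No ordering makes all four pairs consecutive, as they would form a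
4-cycle in a path (`splits_or_splits`). So one of the two configurations is split with probability
of order `n ^ (-2)`, the order of the lower bound in `le_positionLaw_twoPairs`. Summing over about
`n ^ 4` quadruples gives order `n ^ 2`, while each misplaced pair is counted at most `2 * n` times
(`sum_twoPairs_le`). -/

/-- The product outer measure is the largest one dominated by the product of the masses on boxes, so
a comparison on boxes suffices. -/
theorem measure_pi_mono {ι : Type*} [Fintype ι] {α : ι → Type*} [∀ i, MeasurableSpace (α i)]
    {μ ν : ∀ i, Measure (α i)} [∀ i, SigmaFinite (μ i)] [∀ i, SigmaFinite (ν i)]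
    (h : ∀ i, ν i ≤ μ i) : Measure.pi ν ≤ Measure.pi μ := by
  have key : (Measure.pi ν).toOuterMeasure ≤ OuterMeasure.pi fun i => (μ i).toOuterMeasure := by
    rw [OuterMeasure.le_pi]
    intro s _
    refine (Measure.pi_pi ν s).le.trans ?_
    exact Finset.prod_le_prod' fun i _ => h i (s i)
  refine Measure.le_iff.2 fun s _ => (key s).trans ?_
  rw [Measure.pi]
  exact le_toMeasure_apply _ _ s

/-- A lower bound for the density of `N(a, 1)` on `[0, 1]` when `a ∈ [0, C]`. -/
noncomputable def gaussianFloor (C : ℝ) : ℝ :=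
  (Real.sqrt (2 * Real.pi))⁻¹ * Real.exp (-(C + 1) ^ 2 / 2)

theorem gaussianFloor_pos (C : ℝ) : 0 < gaussianFloor C := by
  unfold gaussianFloor; positivity

/-- The left side does not depend on `a`: it is a common component of all these Gaussians. -/
theorem gaussianFloor_smul_le {C a : ℝ} (ha : 0 ≤ a) (haC : a ≤ C) :
    ENNReal.ofReal (gaussianFloor C) • (volume : Measure ℝ).restrict (Set.Icc 0 1)
      ≤ gaussianReal a 1 := by
  refine Measure.le_iff.2 fun s hs => ?_
  rw [gaussianReal_apply a one_ne_zero, Measure.smul_apply, Measure.restrict_apply hs, smul_eq_mul,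
    ← setLIntegral_const]
  refine (setLIntegral_mono' (hs.inter measurableSet_Icc) fun x hx => ?_).trans
    (lintegral_mono_set Set.inter_subset_left)
  obtain ⟨-, hx0, hx1⟩ := hx
  refine ENNReal.ofReal_le_ofReal ?_
  simp only [gaussianFloor, gaussianPDFReal, NNReal.coe_one, mul_one]
  refine mul_le_mul_of_nonneg_left (Real.exp_le_exp.2 ?_) (by positivity)
  have : (x - a) ^ 2 ≤ (C + 1) ^ 2 := sq_le_sq' (by linarith) (by linarith)
  linarith

theorem gaussianFloor_le_one {C : ℝ} (hC : 0 ≤ C) : ENNReal.ofReal (gaussianFloor C) ≤ 1 := by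
  have h := gaussianFloor_smul_le hC le_rfl Set.univ
  simpa using h

theorem noiseLaw_map_add {n : ℕ} (X : Fin n → Fin n → ℝ) :
    (noiseLaw n).map (fun E i j => X i j + E i j)
      = Measure.pi fun i => Measure.pi fun j => gaussianReal (X i j) 1 := by
  have h1 : ∀ i, (Measure.pi fun _ : Fin n => gaussianReal 0 1).map (fun e j => X i j + e j)
      = Measure.pi fun j => gaussianReal (X i j) 1 := by
    intro i
    have h := Measure.pi_map_pi (μ := fun _ : Fin n => gaussianReal 0 1)
      (f := fun j x => X i j + x)
      (hμ := fun j => by rw [gaussianReal_map_const_add]; infer_instance)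
      (fun j => by fun_prop)
    simpa only [gaussianReal_map_const_add, zero_add] using h
  have h := Measure.pi_map_pi (μ := fun _ : Fin n => Measure.pi fun _ : Fin n => gaussianReal 0 1)
      (f := fun i e j => X i j + e j)
      (hμ := fun i => by rw [h1]; infer_instance)
      (fun i => Measurable.aemeasurable (by fun_prop))
  simp only [h1] at h
  exact h

/-- If two signal matrices with entries in `[0, C]` differ in at most `8` entries, then no test
can distinguish them with small error. -/
theorem gaussianFloor_pow_le_error {C : ℝ} (hC : 0 ≤ C) {n : ℕ} {X X' : Fin n → Fin n → ℝ}
    (hX : ∀ i j, 0 ≤ X i j ∧ X i j ≤ C) (hX' : ∀ i j, 0 ≤ X' i j ∧ X' i j ≤ C)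
    {D : Finset (Fin n × Fin n)} (hD : D.card ≤ 8) (hXX' : ∀ i j, (i, j) ∉ D → X i j = X' i j)
    {B B' : Set (Fin n → Fin n → ℝ)} (hB : MeasurableSet B) (hB' : MeasurableSet B')
    (hBB' : B ∪ B' = Set.univ) :
    ENNReal.ofReal (gaussianFloor C) ^ 8 ≤
      noiseLaw n {E | (fun i j => X i j + E i j) ∈ B}
        + noiseLaw n {E | (fun i j => X' i j + E i j) ∈ B'} := by
  classical
  set ε := ENNReal.ofReal (gaussianFloor C)
  have hε : ε ≤ 1 := gaussianFloor_le_one hC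
  -- A common minorant of both data laws: the uniform component where the signals may differ, the
  -- shared Gaussian elsewhere. Its product has mass at least `ε ^ 8`, and `B ∪ B'` carries all of
  -- it.
  let κ : Fin n → Fin n → Measure ℝ := fun i j =>
    if (i, j) ∈ D then ε • (volume : Measure ℝ).restrict (Set.Icc 0 1) else gaussianReal (X i j) 1
  have hfin : ∀ i j, IsFiniteMeasure (κ i j) := by
    intro i j
    simp only [κ]
    split_ifs
    · exact Measure.smul_finite _ ENNReal.ofReal_ne_top
    · infer_instance
  have hle : ∀ i j, κ i j ≤ gaussianReal (X i j) 1 := by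
    intro i j
    simp only [κ]
    split_ifs
    · exact gaussianFloor_smul_le (hX i j).1 (hX i j).2
    · exact le_rfl
  have hle' : ∀ i j, κ i j ≤ gaussianReal (X' i j) 1 := by
    intro i j
    simp only [κ]
    split_ifs with h
    · exact gaussianFloor_smul_le (hX' i j).1 (hX' i j).2
    · rw [hXX' i j h]
  have hmass : ∀ i j, κ i j Set.univ = if (i, j) ∈ D then ε else 1 := by
    intro i j
    simp only [κ]
    split_ifs <;> simp
  let ν : Measure (Fin n → Fin n → ℝ) := Measure.pi fun i => Measure.pi fun j => κ i j
  have hν : ε ^ 8 ≤ ν Set.univ := by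
    simp only [ν, Measure.pi_univ, hmass]
    rw [← Fintype.prod_prod_type' (fun i j => if (i, j) ∈ D then ε else 1)]
    simp only [Prod.mk.eta, Finset.prod_ite_mem, Finset.univ_inter, Finset.prod_const]
    exact pow_le_pow_right_of_le_one' hε hD
  have hνX : ν ≤ (noiseLaw n).map (fun E i j => X i j + E i j) := by
    rw [noiseLaw_map_add]
    exact measure_pi_mono fun i => measure_pi_mono fun j => hle i j
  have hνX' : ν ≤ (noiseLaw n).map (fun E i j => X' i j + E i j) := by
    rw [noiseLaw_map_add]
    exact measure_pi_mono fun i => measure_pi_mono fun j => hle' i j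
  calc ε ^ 8 ≤ ν (B ∪ B') := by rwa [hBB']
    _ ≤ ν B + ν B' := measure_union_le _ _
    _ ≤ _ := add_le_add (hνX B) (hνX' B')
    _ = _ := by
      rw [Measure.map_apply (by fun_prop) hB, Measure.map_apply (by fun_prop) hB']
      rfl

/-! ### Isolated pairs and the loss -/

/-- The vertices `i ≠ j` are adjacent, and have no further neighbours. -/
def IsolatedPair {n : ℕ} (a : Fin n → Fin n → Bool) (i j : Fin n) : Prop :=
  i ≠ j ∧ a i j = true ∧ ∀ m, m ≠ i → m ≠ j → a i m = false ∧ a j m = false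

/-- The vertices `i` and `j` are neighbours in the ordering in which `σ p` has position `p`. -/
def Consecutive {n : ℕ} (σ : Equiv.Perm (Fin n)) (i j : Fin n) : Prop :=
  (σ.symm i : ℕ) + 1 = σ.symm j ∨ (σ.symm j : ℕ) + 1 = σ.symm i

/-- The matrix with entries `u` and `0`, according to an adjacency pattern. -/
def patternMatrix {n : ℕ} (u : ℝ) (a : Fin n → Fin n → Bool) : Matrix (Fin n) (Fin n) ℝ :=
  Matrix.of fun i j => if a i j then u else 0

open Classical in
/-- The number of ordered isolated pairs which are not consecutive in an ordering. -/
noncomputable def misplacedCount {n : ℕ} (a : Fin n → Fin n → Bool) (σ : Equiv.Perm (Fin n)) : ℝ :=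
  ∑ i, ∑ j, if IsolatedPair a i j ∧ ¬ Consecutive σ i j then 1 else 0

theorem IsolatedPair.right_unique {n : ℕ} {a : Fin n → Fin n → Bool} {i j k : Fin n}
    (hj : IsolatedPair a i j) (hk : IsolatedPair a i k) : j = k := by
  by_contra h
  have := (hj.2.2 k hk.1.symm (Ne.symm h)).1
  simp [hk.2.1] at this

theorem sum_isolatedPair_le_one {n : ℕ} {a : Fin n → Fin n → Bool} (i : Fin n)
    (p : Fin n → Prop) [DecidablePred p] (hp : ∀ j, p j → IsolatedPair a i j) :
    ∑ j, (if p j then (1 : ℝ) else 0) ≤ 1 := by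
  rw [Finset.sum_boole]
  norm_cast
  refine Finset.card_le_one.2 fun j hj k hk => ?_
  simp only [Finset.mem_filter, Finset.mem_univ, true_and] at hj hk
  exact (hp j hj).right_unique (hp k hk)

theorem misplacedCount_nonneg {n : ℕ} (a : Fin n → Fin n → Bool) (σ : Equiv.Perm (Fin n)) :
    0 ≤ misplacedCount a σ := by
  unfold misplacedCount
  positivity

theorem misplacedCount_le {n : ℕ} (a : Fin n → Fin n → Bool) (σ : Equiv.Perm (Fin n)) :
    misplacedCount a σ ≤ n := by
  classical
  refine (Finset.sum_le_sum fun i _ => sum_isolatedPair_le_one (a := a) i _ fun j hj => hj.1).trans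
    (by simp)

/-- A row of a Robinson matrix cannot fit well an isolated pair which is split by the ordering. -/
theorem half_sq_le_row {n : ℕ} {u : ℝ} {a : Fin n → Fin n → Bool} {σ : Equiv.Perm (Fin n)}
    {R : Matrix (Fin n) (Fin n) ℝ} (hR : IsRobinson R) {p q : Fin n}
    (hpq : IsolatedPair a (σ p) (σ q)) (hc : ¬ Consecutive σ (σ p) (σ q)) (hu : 0 ≤ u) :
    u ^ 2 / 2 ≤ ∑ r, (permAct σ (patternMatrix u a) - R) p r ^ 2 := by
  have hne : p ≠ q := fun h => hpq.1 (by rw [h])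
  simp only [Consecutive, Equiv.symm_apply_apply, not_or] at hc
  -- As `p` and `q` are not consecutive, the successor of the smaller lies strictly between them;
  -- unimodality at `p` does the rest.
  obtain ⟨r, hrp, hrq, hle⟩ : ∃ r, r ≠ p ∧ r ≠ q ∧ R p q ≤ R p r := by
    rcases lt_or_gt_of_ne hne with h | h
    · have h' : (p : ℕ) < q := h
      refine ⟨⟨p + 1, by omega⟩, ?_, ?_, (hR.2 p).2 _ _ ?_ ?_⟩
      · simp [Fin.ext_iff]
      · simp only [ne_eq, Fin.ext_iff]; omega
      · simp [Fin.le_def]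
      · simp only [Fin.le_def]; omega
    · have h' : (q : ℕ) < p := h
      refine ⟨⟨q + 1, by omega⟩, ?_, ?_, (hR.2 p).1 _ _ ?_ ?_⟩
      · simp only [ne_eq, Fin.ext_iff]; omega
      · simp [Fin.ext_iff]
      · simp [Fin.le_def]
      · simp only [Fin.le_def]; omega
  have h0 : a (σ p) (σ r) = false :=
    (hpq.2.2 (σ r) (σ.injective.ne hrp) (σ.injective.ne hrq)).1
  have h1 : permAct σ (patternMatrix u a) p q = u := by
    simp [permAct_apply, patternMatrix, hpq.2.1]
  have h2 : permAct σ (patternMatrix u a) p r = 0 := by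
    simp [permAct_apply, patternMatrix, h0]
  -- The sum of squares is at least `(u - R p q + R p r) ^ 2 / 2`, and the base is at least `u`.
  calc u ^ 2 / 2 ≤ (u - R p q) ^ 2 + (0 - R p r) ^ 2 := by
        nlinarith [sq_nonneg (u - R p q - R p r), sq_nonneg (R p q + R p r - u),
          sq_nonneg (u - R p q + R p r), sq_nonneg (R p r - R p q)]
    _ = ∑ s ∈ {q, r}, (permAct σ (patternMatrix u a) - R) p s ^ 2 := by
        rw [Finset.sum_pair hrq.symm, Matrix.sub_apply, Matrix.sub_apply, h1, h2]
    _ ≤ _ := Finset.sum_le_sum_of_subset_of_nonneg (Finset.subset_univ _)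
        fun _ _ _ => sq_nonneg _

theorem misplacedCount_le_frobenius_sq {n : ℕ} {u : ℝ} (hu : 0 ≤ u) (a : Fin n → Fin n → Bool)
    (σ : Equiv.Perm (Fin n)) {R : Matrix (Fin n) (Fin n) ℝ} (hR : IsRobinson R) :
    u ^ 2 / 2 * misplacedCount a σ
      ≤ ∑ p, ∑ q, (permAct σ (patternMatrix u a) - R) p q ^ 2 := by
  classical
  rw [misplacedCount, ← Equiv.sum_comp σ, Finset.mul_sum]
  refine Finset.sum_le_sum fun p _ => ?_
  by_cases h : ∃ q, IsolatedPair a (σ p) q ∧ ¬ Consecutive σ (σ p) q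
  · obtain ⟨q, hq, hc⟩ := h
    obtain ⟨q, rfl⟩ := σ.surjective q
    refine le_trans ?_ (half_sq_le_row hR hq hc hu)
    exact mul_le_of_le_one_right (by positivity)
      (sum_isolatedPair_le_one (a := a) (σ p) _ fun j hj => hj.1)
  · push Not at h
    rw [Finset.sum_eq_zero, mul_zero]
    · exact Finset.sum_nonneg fun _ _ => sq_nonneg _
    · intro q _
      rw [if_neg]
      exact fun hq => hq.2 (h q hq.1)

/-- The natural bound involves the square root of the count. Since the count is at most `n`, it can
be replaced by a linear bound, for which a lower bound on the mean count is enough. -/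
theorem misplacedCount_le_loss {n : ℕ} {u : ℝ} (hu : 0 ≤ u) (a : Fin n → Fin n → Bool)
    (σ : Equiv.Perm (Fin n)) :
    u / (2 * Real.sqrt n) * misplacedCount a σ ≤ loss (patternMatrix u a) σ := by
  have : Nonempty {R : Matrix (Fin n) (Fin n) ℝ // IsRobinson R} := ⟨⟨0, isRobinson_zero n⟩⟩
  refine le_ciInf fun R => Real.le_sqrt_of_sq_le ?_
  refine le_trans ?_ (misplacedCount_le_frobenius_sq hu a σ R.2)
  rcases Nat.eq_zero_or_pos n with rfl | hn
  · simp [misplacedCount]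
  have hM := misplacedCount_nonneg a σ
  have hMn := misplacedCount_le a σ
  have hn' : (0 : ℝ) < n := by exact_mod_cast hn
  rw [mul_pow, div_pow, mul_pow, Real.sq_sqrt hn'.le, div_mul_eq_mul_div,
    div_le_iff₀ (by positivity)]
  have h1 : misplacedCount a σ ^ 2 ≤ misplacedCount a σ * n := by
    rw [sq]; exact mul_le_mul_of_nonneg_left hMn hM
  have h2 : 0 ≤ u ^ 2 * (misplacedCount a σ * n) := by positivity
  nlinarith [mul_le_mul_of_nonneg_left h1 (sq_nonneg u)]

/-! ### Pairs of isolated pairs -/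

/-- The isolated pairs `{i, j}` and `{k, l}` are present and disjoint. -/
def TwoPairs {n : ℕ} (a : Fin n → Fin n → Bool) (i j k l : Fin n) : Prop :=
  (i ≠ k ∧ i ≠ l ∧ j ≠ k ∧ j ≠ l) ∧ IsolatedPair a i j ∧ IsolatedPair a k l

/-- The ordering separates one of the pairs `{i, j}` and `{k, l}`. -/
def Splits {n : ℕ} (σ : Equiv.Perm (Fin n)) (i j k l : Fin n) : Prop :=
  ¬ Consecutive σ i j ∨ ¬ Consecutive σ k l

/-- A path contains no cycle of length four. -/
theorem splits_or_splits {n : ℕ} (σ : Equiv.Perm (Fin n)) {i j k l : Fin n} (hik : i ≠ k)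
    (hjl : j ≠ l) : Splits σ i j k l ∨ Splits σ i l k j := by
  have h1 : (σ.symm i : ℕ) ≠ σ.symm k := fun h => hik (σ.symm.injective (Fin.ext h))
  have h2 : (σ.symm j : ℕ) ≠ σ.symm l := fun h => hjl (σ.symm.injective (Fin.ext h))
  unfold Splits Consecutive
  omega

open Classical in
-- One of the two pairs is misplaced, whence the factor 2; the other is one of at most `n` ordered
-- isolated pairs, because a vertex has at most one partner.
theorem sum_twoPairs_le {n : ℕ} (a : Fin n → Fin n → Bool) (σ : Equiv.Perm (Fin n)) :
    ∑ i, ∑ j, ∑ k, ∑ l, (if TwoPairs a i j k l ∧ Splits σ i j k l then (1 : ℝ) else 0)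
      ≤ 2 * n * misplacedCount a σ := by
  let f : Fin n → Fin n → ℝ := fun i j => if IsolatedPair a i j ∧ ¬ Consecutive σ i j then 1 else 0
  let g : Fin n → Fin n → ℝ := fun i j => if IsolatedPair a i j then 1 else 0
  have hg : ∑ i, ∑ j, g i j ≤ n :=
    (Finset.sum_le_sum fun i _ => sum_isolatedPair_le_one (a := a) i _ fun j hj => hj).trans
      (by simp)
  have hpt : ∀ i j k l, (if TwoPairs a i j k l ∧ Splits σ i j k l then (1 : ℝ) else 0)
      ≤ f i j * g k l + g i j * f k l := by
    intro i j k l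
    simp only [f, g, TwoPairs, Splits]
    by_cases h1 : IsolatedPair a i j <;> by_cases h2 : IsolatedPair a k l <;>
      by_cases h3 : Consecutive σ i j <;> by_cases h4 : Consecutive σ k l <;>
      simp [h1, h2, h3, h4] <;> split_ifs <;> norm_num
  have hM := misplacedCount_nonneg a σ
  calc _ ≤ ∑ i, ∑ j, ∑ k, ∑ l, (f i j * g k l + g i j * f k l) := by
        gcongr with i _ j _ k _ l _
        exact hpt i j k l
    _ = (∑ i, ∑ j, f i j) * (∑ k, ∑ l, g k l) + (∑ i, ∑ j, g i j) * (∑ k, ∑ l, f k l) := by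
        simp only [Finset.sum_add_distrib, ← Finset.mul_sum, ← Finset.sum_mul]
    _ = 2 * (∑ k, ∑ l, g k l) * misplacedCount a σ := by
        simp only [misplacedCount, f]; ring
    _ ≤ _ := by gcongr

/-! ### The adjacency pattern of uniform positions -/

instance : IsProbabilityMeasure ((volume : Measure ℝ).restrict (Set.Icc 0 1)) :=
  ⟨by simp⟩

instance (n : ℕ) : IsProbabilityMeasure (positionLaw n) := by
  unfold positionLaw; infer_instance

instance (n : ℕ) : IsProbabilityMeasure (noiseLaw n) := by
  unfold noiseLaw; infer_instance

/-- The adjacency pattern of the positions `V`. -/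
noncomputable def bandPattern {n : ℕ} (V : Fin n → ℝ) (i j : Fin n) : Bool :=
  decide (|V i - V j| ≤ 1 / (n : ℝ))

theorem latentMatrix_bandFun {n : ℕ} (u : ℝ) (V : Fin n → ℝ) :
    latentMatrix (bandFun u n) V = patternMatrix u (bandPattern V) := by
  ext i j
  simp [latentMatrix, bandFun, patternMatrix, bandPattern]

theorem bandPattern_comm {n : ℕ} (V : Fin n → ℝ) (i j : Fin n) :
    bandPattern V i j = bandPattern V j i := by
  simp only [bandPattern, abs_sub_comm]

theorem bandPattern_self {n : ℕ} (V : Fin n → ℝ) (i : Fin n) : bandPattern V i i = true := by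
  simp [bandPattern]

theorem measurable_bandPattern {n : ℕ} :
    Measurable (bandPattern : (Fin n → ℝ) → Fin n → Fin n → Bool) := by
  refine measurable_pi_lambda _ fun i => measurable_pi_lambda _ fun j => ?_
  refine measurable_to_bool ?_
  have : (fun V : Fin n → ℝ => bandPattern V i j) ⁻¹' {true}
      = {V | |V i - V j| ≤ 1 / (n : ℝ)} := by
    ext V; simp [bandPattern]
  rw [this]
  exact measurableSet_le (by fun_prop) measurable_const

/-- There are finitely many patterns, so any condition on them is measurable. -/
theorem measurableSet_bandPattern {n : ℕ} (p : (Fin n → Fin n → Bool) → Prop) :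
    MeasurableSet {V : Fin n → ℝ | p (bandPattern V)} :=
  measurable_bandPattern (Set.toFinite {a | p a}).measurableSet

/-- The positions which are close to neither of two cells of the grid of mesh `1 / n`. -/
def farSet (n a b : ℕ) : Set ℝ :=
  (Set.Icc (((a : ℝ) - 1) / n) ((a + 2) / n) ∪ Set.Icc (((b : ℝ) - 1) / n) ((b + 2) / n))ᶜ

/-- The positions for which `i`, `j` are in the cell `a`, `k`, `l` are in the cell `b`, and the
others are far. -/
def cellBox {n : ℕ} (i j k l : Fin n) (a b : ℕ) (m : Fin n) : Set ℝ :=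
  if m = i ∨ m = j then Set.Ico ((a : ℝ) / n) ((a + 1) / n)
  else if m = k ∨ m = l then Set.Ico ((b : ℝ) / n) ((b + 1) / n) else farSet n a b

theorem measureReal_cell {n a : ℕ} (h : a + 1 ≤ n) :
    ((volume : Measure ℝ).restrict (Set.Icc 0 1)).real (Set.Ico ((a : ℝ) / n) ((a + 1) / n))
      = 1 / n := by
  have hn : (0 : ℝ) < n := by exact_mod_cast (by omega : 0 < n)
  have h' : (a : ℝ) + 1 ≤ n := by exact_mod_cast h
  rw [measureReal_restrict_apply measurableSet_Ico, Set.inter_eq_left.2, Real.volume_real_Ico_of_le]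
  · ring
  · gcongr; linarith
  · refine fun x hx => ⟨le_trans (by positivity) hx.1, hx.2.le.trans ?_⟩
    rwa [div_le_one hn]

theorem le_measureReal_farSet {n : ℕ} (hn : 0 < n) (a b : ℕ) :
    1 - 6 / (n : ℝ) ≤ ((volume : Measure ℝ).restrict (Set.Icc 0 1)).real (farSet n a b) := by
  have hn' : (0 : ℝ) < n := by exact_mod_cast hn
  have h : ∀ c : ℕ, ((volume : Measure ℝ).restrict (Set.Icc 0 1)).real
      (Set.Icc (((c : ℝ) - 1) / n) ((c + 2) / n)) ≤ 3 / n := by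
    intro c
    rw [measureReal_restrict_apply measurableSet_Icc]
    refine (measureReal_mono Set.inter_subset_left (by simp)).trans ?_
    rw [Real.volume_real_Icc_of_le (by gcongr; linarith)]
    exact le_of_eq (by ring)
  rw [farSet, probReal_compl_eq_one_sub (by measurability)]
  have h2 := measureReal_union_le (μ := (volume : Measure ℝ).restrict (Set.Icc 0 1))
    (Set.Icc (((a : ℝ) - 1) / n) ((a + 2) / n)) (Set.Icc (((b : ℝ) - 1) / n) ((b + 2) / n))
  have h3 : (6 : ℝ) / n = 3 / n + 3 / n := by ring
  linarith [h a, h b]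

theorem measurableSet_cellBox {n : ℕ} (i j k l : Fin n) (a b : ℕ) (m : Fin n) :
    MeasurableSet (cellBox i j k l a b m) := by
  unfold cellBox farSet
  split_ifs <;> measurability

/-- The inverse of `1 - 6 / n` is `1 + 6 / (n - 6) ≤ exp (6 / (n - 6))`, and `6 * n / (n - 6) ≤ 12`
exactly when `n ≥ 12` (given `n > 6`). -/
theorem exp_neg_le_one_sub_pow {n : ℕ} (hn : 12 ≤ n) :
    Real.exp (-12) ≤ (1 - 6 / (n : ℝ)) ^ n := by
  have hn' : (12 : ℝ) ≤ n := by exact_mod_cast hn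
  have h6 : (0 : ℝ) < n - 6 := by linarith
  have h1 : Real.exp (-(6 / ((n : ℝ) - 6))) ≤ 1 - 6 / (n : ℝ) := by
    rw [Real.exp_neg]
    have h2 : 1 - 6 / (n : ℝ) = (6 / ((n : ℝ) - 6) + 1)⁻¹ := by
      field_simp
      ring
    rw [h2]
    exact inv_anti₀ (by positivity) (Real.add_one_le_exp _)
  refine le_trans ?_ (pow_le_pow_left₀ (Real.exp_pos _).le h1 n)
  rw [← Real.exp_nat_mul, Real.exp_le_exp, mul_neg, neg_le_neg_iff, mul_div_assoc',
    div_le_iff₀ h6]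
  linarith

theorem le_positionLaw_cellBox {n : ℕ} (hn : 12 ≤ n) {i j k l : Fin n} {a b : ℕ}
    (ha : a + 1 ≤ n) (hb : b + 1 ≤ n) :
    (1 / (n : ℝ)) ^ 4 * Real.exp (-12)
      ≤ (positionLaw n).real (Set.univ.pi (cellBox i j k l a b)) := by
  classical
  have hn' : (12 : ℝ) ≤ n := by exact_mod_cast hn
  have h0 : 0 ≤ 1 - 6 / (n : ℝ) := by
    rw [sub_nonneg, div_le_one (by linarith)]; linarith
  have h1 : 1 - 6 / (n : ℝ) ≤ 1 := by
    rw [sub_le_self_iff]; positivity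
  have h2 : 1 / (n : ℝ) ≤ 1 := by
    rw [div_le_one (by linarith)]; linarith
  rw [positionLaw, measureReal_def, Measure.pi_pi, ENNReal.toReal_prod]
  let F : Finset (Fin n) := {i, j, k, l}
  have hF : F.card ≤ 4 := Finset.card_le_four
  calc (1 / (n : ℝ)) ^ 4 * Real.exp (-12)
      -- Both bases are at most 1, so the exponents may be raised to 4 and `n`, even if some of the
      -- four indices coincide.
      ≤ (1 / (n : ℝ)) ^ F.card * (1 - 6 / (n : ℝ)) ^ (Finset.univ.filter (· ∉ F)).card := by
        refine mul_le_mul (pow_le_pow_of_le_one (by positivity) h2 hF)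
          ((exp_neg_le_one_sub_pow hn).trans (pow_le_pow_of_le_one h0 h1 ?_)) (Real.exp_pos _).le
          (by positivity)
        exact (Finset.card_le_univ _).trans (by simp)
    _ = ∏ m, if m ∈ F then 1 / (n : ℝ) else 1 - 6 / (n : ℝ) := by
        rw [Finset.prod_ite, Finset.prod_const, Finset.prod_const]
        simp
    _ ≤ _ := by
        refine Finset.prod_le_prod (fun m _ => by split_ifs <;> positivity) fun m _ => ?_
        rw [← measureReal_def]
        simp only [F, cellBox, Finset.mem_insert, Finset.mem_singleton]
        by_cases h3 : m = i ∨ m = j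
        · rw [if_pos h3, if_pos (by tauto), measureReal_cell ha]
        · by_cases h4 : m = k ∨ m = l
          · rw [if_neg h3, if_pos h4, if_pos (by tauto), measureReal_cell hb]
          · rw [if_neg h3, if_neg h4, if_neg (by tauto)]
            exact le_measureReal_farSet (by omega) a b

/-- After scaling by `n`, cells and bandwidth both have length 1: points of one cell are adjacent,
and a point outside `[a - 1, a + 2]` is at distance more than 1 from the cell `a`. The gap `a + 3 ≤
b` keeps each cell outside the zone of the other. -/
theorem twoPairs_of_mem_cellBox {n : ℕ} (hn : 0 < n) {i j k l : Fin n} (hij : i ≠ j) (hkl : k ≠ l)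
    (hd : i ≠ k ∧ i ≠ l ∧ j ≠ k ∧ j ≠ l) {a b : ℕ} (hab : a + 3 ≤ b) {V : Fin n → ℝ}
    (hV : V ∈ Set.univ.pi (cellBox i j k l a b)) : TwoPairs (bandPattern V) i j k l := by
  have hn' : (0 : ℝ) < n := by exact_mod_cast hn
  have hab' : (a : ℝ) + 3 ≤ b := by exact_mod_cast hab
  have hadj : ∀ p q, bandPattern V p q = decide (|V p * n - V q * n| ≤ 1) := by
    intro p q
    simp only [bandPattern, ← sub_mul, abs_mul, abs_of_pos hn', le_div_iff₀ hn']
  have h1 : ∀ m, m = i ∨ m = j → (a : ℝ) ≤ V m * n ∧ V m * n < a + 1 := by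
    intro m hm
    have h := hV m (Set.mem_univ m)
    rwa [cellBox, if_pos hm, Set.mem_Ico, div_le_iff₀ hn', lt_div_iff₀ hn'] at h
  have h2 : ∀ m, m = k ∨ m = l → (b : ℝ) ≤ V m * n ∧ V m * n < b + 1 := by
    intro m hm
    have h := hV m (Set.mem_univ m)
    have hm' : ¬ (m = i ∨ m = j) := by grind
    rwa [cellBox, if_neg hm', if_pos hm, Set.mem_Ico, div_le_iff₀ hn', lt_div_iff₀ hn'] at h
  have h3 : ∀ m, ¬ (m = i ∨ m = j) → ¬ (m = k ∨ m = l) →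
      (V m * n < a - 1 ∨ a + 2 < V m * n) ∧ (V m * n < b - 1 ∨ b + 2 < V m * n) := by
    intro m hm hm'
    have h := hV m (Set.mem_univ m)
    rw [cellBox, if_neg hm, if_neg hm', farSet, Set.mem_compl_iff, Set.mem_union, not_or,
      Set.mem_Icc, Set.mem_Icc, div_le_iff₀ hn', le_div_iff₀ hn', div_le_iff₀ hn', le_div_iff₀ hn',
      not_and_or, not_and_or, not_le, not_le, not_le, not_le] at h
    exact h
  have hclose : ∀ {c x y : ℝ}, (c ≤ x ∧ x < c + 1) → (c ≤ y ∧ y < c + 1) → |x - y| ≤ 1 := by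
    intro c x y hx hy
    rw [abs_le]; constructor <;> linarith [hx.1, hx.2, hy.1, hy.2]
  have hfar : ∀ {c x y : ℝ}, (c ≤ x ∧ x < c + 1) → (y < c - 1 ∨ c + 2 < y) → ¬ |x - y| ≤ 1 := by
    intro c x y hx hy h
    rw [abs_le] at h
    rcases hy with hy | hy <;> linarith [hx.1, hx.2, h.1, h.2]
  simp only [TwoPairs, IsolatedPair, hadj, decide_eq_true_eq, decide_eq_false_iff_not]
  refine ⟨hd, ⟨hij, hclose (h1 i (.inl rfl)) (h1 j (.inr rfl)), fun m hi hj => ?_⟩,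
    ⟨hkl, hclose (h2 k (.inl rfl)) (h2 l (.inr rfl)), fun m hk hl => ?_⟩⟩
  · have hm : V m * n < a - 1 ∨ a + 2 < V m * n := by
      by_cases h : m = k ∨ m = l
      · right; linarith [(h2 m h).1]
      · exact (h3 m (by tauto) h).1
    exact ⟨hfar (h1 i (.inl rfl)) hm, hfar (h1 j (.inr rfl)) hm⟩
  · have hm : V m * n < b - 1 ∨ b + 2 < V m * n := by
      by_cases h : m = i ∨ m = j
      · left; linarith [(h1 m h).2]
      · exact (h3 m h (by tauto)).2
    exact ⟨hfar (h2 k (.inl rfl)) hm, hfar (h2 l (.inr rfl)) hm⟩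

theorem cell_unique {n : ℕ} (hn : 0 < n) {a b : ℕ} {x : ℝ}
    (ha : x ∈ Set.Ico ((a : ℝ) / n) ((a + 1) / n)) (hb : x ∈ Set.Ico ((b : ℝ) / n) ((b + 1) / n)) :
    a = b := by
  have hn' : (0 : ℝ) < n := by exact_mod_cast hn
  rw [Set.mem_Ico, div_le_iff₀ hn', lt_div_iff₀ hn'] at ha hb
  have h1 : (a : ℝ) < b + 1 := by linarith
  have h2 : (b : ℝ) < a + 1 := by linarith
  norm_cast at h1 h2
  omega

theorem le_positionLaw_twoPairs {n : ℕ} (hn : 12 ≤ n) {i j k l : Fin n} (hij : i ≠ j)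
    (hkl : k ≠ l) (hd : i ≠ k ∧ i ≠ l ∧ j ≠ k ∧ j ≠ l) :
    Real.exp (-12) / 64 / (n : ℝ) ^ 2
      ≤ (positionLaw n).real {V | TwoPairs (bandPattern V) i j k l} := by
  have hn' : (12 : ℝ) ≤ n := by exact_mod_cast hn
  -- The cells are `a < m` and `b = m + 3 + c` with `c < m`: separated, inside `[0, 1]`, and giving
  -- at least `(n / 8) ^ 2` disjoint boxes of mass at least `exp (-12) / n ^ 4`.
  obtain ⟨m, hm1, hm2⟩ : ∃ m : ℕ, 2 * m + 3 ≤ n ∧ n ≤ 8 * m := ⟨n / 4, by omega, by omega⟩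
  let U : ℕ × ℕ → Set (Fin n → ℝ) := fun c => Set.univ.pi (cellBox i j k l c.1 (m + 3 + c.2))
  let I : Finset (ℕ × ℕ) := Finset.range m ×ˢ Finset.range m
  have hdisj : Set.PairwiseDisjoint (↑I) U := by
    intro c _ d _ hcd
    rw [Function.onFun, Set.disjoint_left]
    intro V hc hd'
    apply hcd
    have hi := hc i (Set.mem_univ i)
    have hi' := hd' i (Set.mem_univ i)
    have hk := hc k (Set.mem_univ k)
    have hk' := hd' k (Set.mem_univ k)
    have hk0 : ¬ (k = i ∨ k = j) := by grind
    rw [cellBox, if_pos (.inl rfl)] at hi hi'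
    rw [cellBox, if_neg hk0, if_pos (.inl rfl)] at hk hk'
    have e1 := cell_unique (by omega) hi hi'
    have e2 := cell_unique (by omega) hk hk'
    exact Prod.ext e1 (by omega)
  have hmeas : ∀ c ∈ I, MeasurableSet (U c) := fun c _ =>
    MeasurableSet.univ_pi fun p => measurableSet_cellBox _ _ _ _ _ _ p
  have hm3 : (n : ℝ) ≤ 8 * m := by exact_mod_cast hm2
  calc Real.exp (-12) / 64 / (n : ℝ) ^ 2
      = ((n : ℝ) / 8) ^ 2 * ((1 / (n : ℝ)) ^ 4 * Real.exp (-12)) := by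
        field_simp
        norm_num
    _ ≤ (m : ℝ) ^ 2 * ((1 / (n : ℝ)) ^ 4 * Real.exp (-12)) := by
        gcongr; linarith
    _ = ∑ c ∈ I, (1 / (n : ℝ)) ^ 4 * Real.exp (-12) := by
        simp [I, sq]
    _ ≤ ∑ c ∈ I, (positionLaw n).real (U c) := by
        refine Finset.sum_le_sum fun c hc => ?_
        simp only [I, Finset.mem_product, Finset.mem_range] at hc
        exact le_positionLaw_cellBox hn (by omega) (by omega)
    _ = (positionLaw n).real (⋃ c ∈ I, U c) := (measureReal_biUnion_finset hdisj hmeas).symm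
    _ ≤ _ := by
        refine measureReal_mono ?_
        refine Set.iUnion₂_subset fun c hc V hV => ?_
        simp only [I, Finset.mem_product, Finset.mem_range] at hc
        exact twoPairs_of_mem_cellBox (by omega) hij hkl hd (by omega) hV

theorem measurePreserving_comp_perm {n : ℕ} (τ : Equiv.Perm (Fin n)) :
    MeasurePreserving (fun V : Fin n → ℝ => V ∘ τ) (positionLaw n) (positionLaw n) := by
  have h := measurePreserving_piCongrLeft
    (fun _ : Fin n => (volume : Measure ℝ).restrict (Set.Icc 0 1)) τ.symm
  rw [positionLaw]
  convert h using 1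
  ext V i
  have := MeasurableEquiv.piCongrLeft_apply_apply τ.symm (β := fun _ => ℝ) V (τ i)
  simpa using this.symm

/-! ### Exchanging two vertices -/

theorem isolatedPair_comp_perm {n : ℕ} (a : Fin n → Fin n → Bool) (τ : Equiv.Perm (Fin n))
    (i j : Fin n) :
    IsolatedPair (fun p q => a (τ p) (τ q)) i j ↔ IsolatedPair a (τ i) (τ j) := by
  simp only [IsolatedPair, ne_eq, τ.injective.eq_iff]
  refine and_congr_right fun _ => and_congr_right fun _ => ?_
  rw [← τ.forall_congr_right (q := fun m => ¬ m = τ i → ¬ m = τ j →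
    a (τ i) m = false ∧ a (τ j) m = false)]
  simp only [τ.injective.eq_iff]

theorem twoPairs_comp_swap {n : ℕ} (a : Fin n → Fin n → Bool) {i j k l : Fin n}
    (h : TwoPairs a i j k l) :
    TwoPairs (fun p q => a (Equiv.swap j l p) (Equiv.swap j l q)) i l k j := by
  obtain ⟨⟨h1, h2, h3, h4⟩, hij, hkl⟩ := h
  refine ⟨⟨h1, hij.1, hkl.1.symm, h4.symm⟩, ?_, ?_⟩
  · rw [isolatedPair_comp_perm, Equiv.swap_apply_right, Equiv.swap_apply_of_ne_of_ne hij.1 h2]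
    exact hij
  · rw [isolatedPair_comp_perm, Equiv.swap_apply_left,
      Equiv.swap_apply_of_ne_of_ne h3.symm hkl.1]
    exact hkl

/-- Vertices outside the four are adjacent to none of them, before and after the exchange; entries
inside `{i, k}` are fixed, and those inside `{j, l}` are preserved by symmetry and the constant
diagonal. -/
theorem swap_eq_of_notMem {n : ℕ} {a : Fin n → Fin n → Bool} (hs : ∀ p q, a p q = a q p)
    (hr : ∀ p, a p p = true) {i j k l : Fin n} (h : TwoPairs a i j k l) {p q : Fin n}
    (hpq : (p, q) ∉ ({i, k} ×ˢ {j, l} ∪ {j, l} ×ˢ {i, k} : Finset (Fin n × Fin n))) :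
    a p q = a (Equiv.swap j l p) (Equiv.swap j l q) := by
  obtain ⟨⟨h1, h2, h3, h4⟩, ⟨hij, -, hi⟩, ⟨hkl, -, hk⟩⟩ := h
  simp only [Finset.mem_union, Finset.mem_product, Finset.mem_insert, Finset.mem_singleton,
    not_or, not_and_or] at hpq
  simp only [Equiv.swap_apply_def]
  split_ifs <;> grind

theorem card_swap_le {n : ℕ} (i j k l : Fin n) :
    ({i, k} ×ˢ {j, l} ∪ {j, l} ×ˢ {i, k} : Finset (Fin n × Fin n)).card ≤ 8 := by
  refine (Finset.card_union_le _ _).trans ?_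
  rw [Finset.card_product, Finset.card_product]
  nlinarith [Finset.card_le_two (a := i) (b := k), Finset.card_le_two (a := j) (b := l)]

/-! ### Outcomes of an estimator -/

/-- The ordering estimated from the pattern of the positions `p.1` and from the noise `p.2`. -/
noncomputable def Estimator.outcome {n : ℕ} (S : Estimator n) (u : ℝ)
    (p : (Fin n → ℝ) × (Fin n → Fin n → ℝ)) : Equiv.Perm (Fin n) :=
  S.toFun fun i j => patternMatrix u (bandPattern p.1) i j + p.2 i j

theorem Estimator.measurableSet_preimage {n : ℕ} (S : Estimator n)
    (P : Equiv.Perm (Fin n) → Prop) : MeasurableSet {Y | P (S.toFun Y)} := by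
  have : {Y | P (S.toFun Y)} = ⋃ σ ∈ {σ | P σ}, S.toFun ⁻¹' {σ} := by
    ext Y; simp
  rw [this]
  exact (Set.toFinite _).measurableSet_biUnion fun σ _ => S.measurableSet_fiber σ

theorem measurable_patternMatrix {n : ℕ} (u : ℝ) (i j : Fin n) :
    Measurable fun V : Fin n → ℝ => patternMatrix u (bandPattern V) i j := by
  have : (fun V : Fin n → ℝ => patternMatrix u (bandPattern V) i j)
      = (fun a : Fin n → Fin n → Bool => patternMatrix u a i j) ∘ bandPattern := rfl
  rw [this]
  exact (measurable_of_finite _).comp measurable_bandPattern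

/-- Everything factors through the finite set of pairs (pattern, ordering). In particular the loss
is measurable without any study of its infimum. -/
theorem Estimator.measurable_comp_outcome {n : ℕ} (S : Estimator n) (u : ℝ) {β : Type*}
    [MeasurableSpace β] (F : (Fin n → Fin n → Bool) → Equiv.Perm (Fin n) → β) :
    Measurable fun p => F (bandPattern p.1) (S.outcome u p) := by
  let _ : MeasurableSpace (Equiv.Perm (Fin n)) := ⊤
  have hY : Measurable fun (p : (Fin n → ℝ) × (Fin n → Fin n → ℝ)) (i j : Fin n) =>
      patternMatrix u (bandPattern p.1) i j + p.2 i j := by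
    refine measurable_pi_lambda _ fun i => measurable_pi_lambda _ fun j => ?_
    exact ((measurable_patternMatrix u i j).comp measurable_fst).add (by fun_prop)
  have h1 : Measurable (S.outcome u) := by
    intro s _
    exact hY (S.measurableSet_preimage (· ∈ s))
  have h2 : Measurable fun p : (Fin n → ℝ) × (Fin n → Fin n → ℝ) =>
      (bandPattern p.1, S.outcome u p) :=
    (measurable_bandPattern.comp measurable_fst).prodMk h1
  exact (measurable_of_finite
    fun c : (Fin n → Fin n → Bool) × Equiv.Perm (Fin n) => F c.1 c.2).comp h2

theorem Estimator.measurableSet_outcome {n : ℕ} (S : Estimator n) (u : ℝ)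
    (P : (Fin n → Fin n → Bool) → Equiv.Perm (Fin n) → Prop) :
    MeasurableSet {p | P (bandPattern p.1) (S.outcome u p)} :=
  measurableSet_setOfPred.2 (S.measurable_comp_outcome u P)

theorem Estimator.integrable_comp_outcome {n : ℕ} (S : Estimator n) (u : ℝ)
    (F : (Fin n → Fin n → Bool) → Equiv.Perm (Fin n) → ℝ) :
    Integrable (fun p => F (bandPattern p.1) (S.outcome u p))
      ((positionLaw n).prod (noiseLaw n)) := by
  refine Integrable.of_bound (S.measurable_comp_outcome u F).aestronglyMeasurable
    (∑ c : (Fin n → Fin n → Bool) × Equiv.Perm (Fin n), ‖F c.1 c.2‖) (ae_of_all _ fun p => ?_)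
  exact Finset.single_le_sum (f := fun c : (Fin n → Fin n → Bool) × Equiv.Perm (Fin n) =>
    ‖F c.1 c.2‖) (fun _ _ => norm_nonneg _) (Finset.mem_univ (bandPattern p.1, S.outcome u p))

/-- The event that `{i, j}` and `{k, l}` are disjoint isolated pairs, one of which is split. -/
def Estimator.splitEvent {n : ℕ} (S : Estimator n) (u : ℝ) (i j k l : Fin n) :
    Set ((Fin n → ℝ) × (Fin n → Fin n → ℝ)) :=
  {p | TwoPairs (bandPattern p.1) i j k l ∧ Splits (S.outcome u p) i j k l}

theorem Estimator.measurableSet_splitEvent {n : ℕ} (S : Estimator n) (u : ℝ) (i j k l : Fin n) :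
    MeasurableSet (S.splitEvent u i j k l) :=
  S.measurableSet_outcome u fun a σ => TwoPairs a i j k l ∧ Splits σ i j k l

theorem patternMatrix_mem {n : ℕ} {u C : ℝ} (hu : 0 ≤ u) (huC : u ≤ C)
    (a : Fin n → Fin n → Bool) (i j : Fin n) :
    0 ≤ patternMatrix u a i j ∧ patternMatrix u a i j ≤ C := by
  simp only [patternMatrix, Matrix.of_apply]
  split_ifs
  · exact ⟨hu, huC⟩
  · exact ⟨le_rfl, hu.trans huC⟩

/-- Exchanging `j` and `l` changes few entries of the signal, and turns the isolated pairs
`{i, j}`, `{k, l}` into `{i, l}`, `{k, j}`, so that the estimator cannot do well in both cases. -/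
theorem Estimator.le_splitEvent_add {n : ℕ} (S : Estimator n) {u C : ℝ} (hu : 0 ≤ u) (huC : u ≤ C)
    (i j k l : Fin n) :
    ENNReal.ofReal (gaussianFloor C) ^ 8 * positionLaw n {V | TwoPairs (bandPattern V) i j k l}
      ≤ (positionLaw n).prod (noiseLaw n) (S.splitEvent u i j k l)
        + (positionLaw n).prod (noiseLaw n) (S.splitEvent u i l k j) := by
  have hC : 0 ≤ C := hu.trans huC
  let T : Set (Fin n → ℝ) := {V | TwoPairs (bandPattern V) i j k l}
  have hT : MeasurableSet T := measurableSet_bandPattern fun a => TwoPairs a i j k l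
  have hswap : MeasurePreserving
      (Prod.map (fun V : Fin n → ℝ => V ∘ Equiv.swap j l) (id : (Fin n → Fin n → ℝ) → _))
      ((positionLaw n).prod (noiseLaw n)) ((positionLaw n).prod (noiseLaw n)) :=
    (measurePreserving_comp_perm _).prod (MeasurePreserving.id _)
  have hG := S.measurableSet_splitEvent u i j k l
  have hG' := hswap.measurable (S.measurableSet_splitEvent u i l k j)
  -- The second event is pulled back by the exchange of `j` and `l`, so that both are compared at
  -- the same positions `V`, with only the noise left random.
  rw [← hswap.measure_preimage (S.measurableSet_splitEvent u i l k j).nullMeasurableSet,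
    Measure.prod_apply hG, Measure.prod_apply hG', ← lintegral_add_left
      (measurable_measure_prodMk_left hG), ← lintegral_indicator_const hT]
  refine lintegral_mono fun V => ?_
  by_cases hV : V ∈ T
  · have hV' : TwoPairs (bandPattern V) i j k l := hV
    rw [Set.indicator_of_mem hV]
    refine (gaussianFloor_pow_le_error hC (patternMatrix_mem hu huC (bandPattern V))
      (patternMatrix_mem hu huC (bandPattern (V ∘ Equiv.swap j l)))
      (card_swap_le i j k l) ?_ (S.measurableSet_preimage fun σ => Splits σ i j k l)
      (S.measurableSet_preimage fun σ => Splits σ i l k j) ?_).trans (add_le_add ?_ ?_)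
    · intro p q hpq
      have h := swap_eq_of_notMem (bandPattern_comm V) (bandPattern_self V) hV' hpq
      have h' : bandPattern (V ∘ Equiv.swap j l) p q
        = bandPattern V (Equiv.swap j l p) (Equiv.swap j l q) := rfl
      simp only [patternMatrix, Matrix.of_apply, h', h]
    · ext Y
      simpa using splits_or_splits (S.toFun Y) hV'.1.1 hV'.1.2.2.2
    · exact measure_mono fun E hE => ⟨hV', hE⟩
    · exact measure_mono fun E hE => ⟨twoPairs_comp_swap _ hV', hE⟩
  · rw [Set.indicator_of_notMem hV]
    exact zero_le

theorem Estimator.le_splitEvent_add_real {n : ℕ} (hn : 12 ≤ n) (S : Estimator n) {u C : ℝ}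
    (hu : 0 ≤ u) (huC : u ≤ C) {i j k l : Fin n} (hij : i ≠ j) (hkl : k ≠ l)
    (hd : i ≠ k ∧ i ≠ l ∧ j ≠ k ∧ j ≠ l) :
    gaussianFloor C ^ 8 * (Real.exp (-12) / 64 / (n : ℝ) ^ 2)
      ≤ ((positionLaw n).prod (noiseLaw n)).real (S.splitEvent u i j k l)
        + ((positionLaw n).prod (noiseLaw n)).real (S.splitEvent u i l k j) := by
  have h := ENNReal.toReal_mono (by finiteness) (S.le_splitEvent_add hu huC i j k l)
  rw [ENNReal.toReal_add (by finiteness) (by finiteness), ENNReal.toReal_mul, ENNReal.toReal_pow,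
    ENNReal.toReal_ofReal (gaussianFloor_pos C).le] at h
  refine le_trans ?_ h
  have := gaussianFloor_pos C
  gcongr
  exact le_positionLaw_twoPairs hn hij hkl hd

/-! ### The risk -/

/-- The indicator of distinctness is at least 1 minus the six indicators of coincidences, and `n ^ 4
- 6 * n ^ 3 ≥ n ^ 4 / 2` for `n ≥ 12`. -/
theorem le_sum_of_distinct {n : ℕ} (hn : 12 ≤ n) {δ : ℝ} (hδ : 0 ≤ δ)
    {f : Fin n → Fin n → Fin n → Fin n → ℝ} (hf : ∀ i j k l, 0 ≤ f i j k l)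
    (h : ∀ i j k l, i ≠ j → k ≠ l → (i ≠ k ∧ i ≠ l ∧ j ≠ k ∧ j ≠ l) → δ ≤ f i j k l) :
    (n : ℝ) ^ 4 / 2 * δ ≤ ∑ i, ∑ j, ∑ k, ∑ l, f i j k l := by
  have hn' : (12 : ℝ) ≤ n := by exact_mod_cast hn
  let e : Fin n → Fin n → ℝ := fun p q => if p = q then 1 else 0
  have hpt : ∀ i j k l, δ * (1 - e i j - e k l - e i k - e i l - e j k - e j l) ≤ f i j k l := by
    intro i j k l
    have he : ∀ p q, 0 ≤ e p q := fun p q => by simp only [e]; split_ifs <;> norm_num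
    have he1 : ∀ p q, p = q → e p q = 1 := fun p q hpq => if_pos hpq
    have he0 : ∀ p q, p ≠ q → e p q = 0 := fun p q hpq => if_neg hpq
    by_cases hd : i ≠ j ∧ k ≠ l ∧ (i ≠ k ∧ i ≠ l ∧ j ≠ k ∧ j ≠ l)
    · obtain ⟨h1, h2, h3, h4, h5, h6⟩ := hd
      rw [he0 _ _ h1, he0 _ _ h2, he0 _ _ h3, he0 _ _ h4, he0 _ _ h5, he0 _ _ h6]
      simpa using h i j k l h1 h2 ⟨h3, h4, h5, h6⟩
    · refine le_trans (mul_nonpos_of_nonneg_of_nonpos hδ ?_) (hf i j k l)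
      have : i = j ∨ k = l ∨ i = k ∨ i = l ∨ j = k ∨ j = l := by tauto
      rcases this with h | h | h | h | h | h <;>
        linarith [he1 _ _ h, he i j, he k l, he i k, he i l, he j k, he j l]
  calc (n : ℝ) ^ 4 / 2 * δ ≤ δ * ((n : ℝ) ^ 4 - 6 * (n : ℝ) ^ 3) := by
        rw [mul_comm]
        refine mul_le_mul_of_nonneg_left ?_ hδ
        have : (12 : ℝ) * n ^ 3 ≤ n * n ^ 3 := by gcongr
        nlinarith
    _ = ∑ i, ∑ j, ∑ k, ∑ l, δ * (1 - e i j - e k l - e i k - e i l - e j k - e j l) := by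
        simp only [← Finset.mul_sum, Finset.sum_sub_distrib, e, Finset.sum_const, Finset.card_univ,
          Fintype.card_fin, Finset.sum_ite_eq, Finset.mem_univ, if_true, nsmul_eq_mul]
        ring
    _ ≤ _ := by
        gcongr with i _ j _ k _ l _
        exact hpt i j k l

theorem Estimator.le_sum_splitEvent {n : ℕ} (hn : 12 ≤ n) (S : Estimator n) {u C : ℝ}
    (hu : 0 ≤ u) (huC : u ≤ C) :
    gaussianFloor C ^ 8 * Real.exp (-12) / 256 * (n : ℝ) ^ 2
      ≤ ∑ i, ∑ j, ∑ k, ∑ l,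
        ((positionLaw n).prod (noiseLaw n)).real (S.splitEvent u i j k l) := by
  have hn' : (12 : ℝ) ≤ n := by exact_mod_cast hn
  have hC := gaussianFloor_pos C
  set Q : Fin n → Fin n → Fin n → Fin n → ℝ := fun i j k l =>
    ((positionLaw n).prod (noiseLaw n)).real (S.splitEvent u i j k l)
  have h := le_sum_of_distinct hn (δ := gaussianFloor C ^ 8 * (Real.exp (-12) / 64 / (n : ℝ) ^ 2))
    (by positivity) (f := fun i j k l => Q i j k l + Q i l k j) (fun i j k l => by positivity)
    fun i j k l hij hkl hd => S.le_splitEvent_add_real hn hu huC hij hkl hd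
  -- Exchanging `j` and `l` permutes the quadruples, so both configurations contribute the same
  -- total.
  have hsymm : ∑ i, ∑ j, ∑ k, ∑ l, Q i l k j = ∑ i, ∑ j, ∑ k, ∑ l, Q i j k l := by
    refine Finset.sum_congr rfl fun i _ => ?_
    rw [Finset.sum_comm]
    conv_rhs => rw [Finset.sum_comm]
    exact Finset.sum_congr rfl fun k _ => Finset.sum_comm
  simp only [Finset.sum_add_distrib] at h
  rw [hsymm] at h
  have h2 : (n : ℝ) ^ 4 / 2 * (gaussianFloor C ^ 8 * (Real.exp (-12) / 64 / (n : ℝ) ^ 2))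
      = 2 * (gaussianFloor C ^ 8 * Real.exp (-12) / 256 * (n : ℝ) ^ 2) := by
    field_simp
    norm_num
  linarith

theorem Estimator.sum_splitEvent_le {n : ℕ} (S : Estimator n) (u : ℝ) :
    ∑ i, ∑ j, ∑ k, ∑ l, ((positionLaw n).prod (noiseLaw n)).real (S.splitEvent u i j k l)
      ≤ 2 * n * ∫ p, misplacedCount (bandPattern p.1) (S.outcome u p)
          ∂((positionLaw n).prod (noiseLaw n)) := by
  classical
  have hQ : ∀ i j k l, ((positionLaw n).prod (noiseLaw n)).real (S.splitEvent u i j k l)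
      = ∫ p, (if TwoPairs (bandPattern p.1) i j k l ∧ Splits (S.outcome u p) i j k l
          then (1 : ℝ) else 0) ∂((positionLaw n).prod (noiseLaw n)) := by
    intro i j k l
    rw [← integral_indicator_one (S.measurableSet_splitEvent u i j k l)]
    refine integral_congr_ae (ae_of_all _ fun p => ?_)
    simp only [Set.indicator_apply, Estimator.splitEvent, Set.mem_ofPred_eq, Pi.one_apply]
  have hint : ∀ i j k l, Integrable (fun p : (Fin n → ℝ) × (Fin n → Fin n → ℝ) =>
      if TwoPairs (bandPattern p.1) i j k l ∧ Splits (S.outcome u p) i j k l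
        then (1 : ℝ) else 0) ((positionLaw n).prod (noiseLaw n)) := fun i j k l =>
    S.integrable_comp_outcome u fun a σ =>
      if TwoPairs a i j k l ∧ Splits σ i j k l then (1 : ℝ) else 0
  simp only [hQ]
  rw [← integral_const_mul]
  have e : ∑ i, ∑ j, ∑ k, ∑ l, ∫ p, (if TwoPairs (bandPattern p.1) i j k l ∧
      Splits (S.outcome u p) i j k l then (1 : ℝ) else 0) ∂((positionLaw n).prod (noiseLaw n))
      = ∫ p, ∑ i, ∑ j, ∑ k, ∑ l, (if TwoPairs (bandPattern p.1) i j k l ∧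
      Splits (S.outcome u p) i j k l then (1 : ℝ) else 0) ∂((positionLaw n).prod (noiseLaw n)) := by
    rw [integral_finsetSum _ fun i _ => integrable_finsetSum _ fun j _ =>
      integrable_finsetSum _ fun k _ => integrable_finsetSum _ fun l _ => hint i j k l]
    refine Finset.sum_congr rfl fun i _ => ?_
    rw [integral_finsetSum _ fun j _ =>
      integrable_finsetSum _ fun k _ => integrable_finsetSum _ fun l _ => hint i j k l]
    refine Finset.sum_congr rfl fun j _ => ?_
    rw [integral_finsetSum _ fun k _ => integrable_finsetSum _ fun l _ => hint i j k l]
    refine Finset.sum_congr rfl fun k _ => ?_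
    rw [integral_finsetSum _ fun l _ => hint i j k l]
  rw [e]
  refine integral_mono ?_ ?_ fun p => sum_twoPairs_le _ _
  · exact integrable_finsetSum _ fun i _ => integrable_finsetSum _ fun j _ =>
      integrable_finsetSum _ fun k _ => integrable_finsetSum _ fun l _ => hint i j k l
  · exact S.integrable_comp_outcome u fun a σ => 2 * n * misplacedCount a σ

theorem Estimator.misplaced_le_risk {n : ℕ} (S : Estimator n) {u : ℝ} (hu : 0 ≤ u) :
    u / (2 * Real.sqrt n) * ∫ p, misplacedCount (bandPattern p.1) (S.outcome u p)
      ∂((positionLaw n).prod (noiseLaw n)) ≤ risk (bandFun u n) S := by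
  simp only [risk, latentMatrix_bandFun]
  rw [← integral_const_mul]
  refine integral_mono ?_ ?_ fun p => misplacedCount_le_loss hu _ _
  · exact S.integrable_comp_outcome u fun a σ => u / (2 * Real.sqrt n) * misplacedCount a σ
  · exact S.integrable_comp_outcome u fun a σ => loss (patternMatrix u a) σ

theorem Estimator.le_risk {n : ℕ} (hn : 12 ≤ n) (S : Estimator n) {u C : ℝ}
    (hu : 0 ≤ u) (huC : u ≤ C) :
    gaussianFloor C ^ 8 * Real.exp (-12) / 1024 * (u * Real.sqrt n) ≤ risk (bandFun u n) S := by
  have hn' : (0 : ℝ) < n := by exact_mod_cast (by omega : 0 < n)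
  refine le_trans ?_ (S.misplaced_le_risk hu)
  have h := (S.le_sum_splitEvent hn hu huC).trans (S.sum_splitEvent_le u)
  set M := ∫ p, misplacedCount (bandPattern p.1) (S.outcome u p)
    ∂((positionLaw n).prod (noiseLaw n))
  set c := gaussianFloor C ^ 8 * Real.exp (-12)
  -- From `c / 256 * n ^ 2 ≤ 2 * n * M`. The factor `u / (2 * √n)` then turns 512 into 1024.
  have hM : c / 512 * n ≤ M := by
    refine le_of_mul_le_mul_left ?_ (by positivity : (0 : ℝ) < 2 * n)
    refine le_trans (le_of_eq ?_) h
    ring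
  calc c / 1024 * (u * Real.sqrt n) = u / (2 * Real.sqrt n) * (c / 512 * n) := by
        rw [div_mul_eq_mul_div u, eq_div_iff (by positivity)]
        linear_combination (c * u / 512) * Real.mul_self_sqrt hn'.le
    _ ≤ _ := by gcongr

end Seriation

theorem mainTheorem8 :
    ∀ C : ℝ, 0 < C → ∃ c : ℝ, 0 < c ∧ ∃ N : ℕ,
      ∀ u : ℝ, 0 < u → u ≤ C → ∀ n₀ : ℕ, N ≤ n₀ →
        ∃ n : ℕ, (n₀ : ℝ) / 2 ≤ n ∧ (n : ℝ) ≤ 2 * n₀ ∧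
          ∀ S : Seriation.Estimator n,
            c * (u * Real.sqrt n) ≤ Seriation.risk (Seriation.bandFun u n) S := by
  intro C _
  have hC := Seriation.gaussianFloor_pos C
  -- The bound holds for every `n ≥ 12`, so `n = n₀` itself serves.
  refine ⟨Seriation.gaussianFloor C ^ 8 * Real.exp (-12) / 1024, by positivity, 12,
    fun u hu huC n₀ hn₀ => ⟨n₀, ?_, ?_, fun S => S.le_risk hn₀ hu.le huC⟩⟩
  · linarith [(Nat.cast_nonneg n₀ : (0 : ℝ) ≤ n₀)]
  · linarith [(Nat.cast_nonneg n₀ : (0 : ℝ) ≤ n₀)]
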